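/- Let $A$ be a finite alphabet. A word $w = a_1\cdots a_n \in A^*$ is viewed as a structure whose elements are the positions $1,\dots,n$ (the empty word gives the empty structure), with a unary predicate $P_a$ for each $a \in A$ that holds exactly at the positions labelled $a$. Let $\mathrm{FO}(+1)$ (respectively $\mathrm{FO}(N)$) be the class of languages $L \subseteq A^*$ definable by a sentence of first-order logic with equality over the predicates $P_a$, $a\in A$, and the binary predicate $x+1=y$ (respectively the neighbour predicate $N(x,y)$, which holds iff $x+1=y$ or $y+1=x$). Let $\mathrm{Rev}$ be the class of regular languages $L \subseteq A^*$ with $L^r = L$, where $L^r$ is the set of the reverses of the words of $L$. For words $u,y$ let $\sharp(u,y)$ be the number of pairs $(x,z)$ of words with $u = xyz$. For $k,t>0$ let $u \approx_k^t v$ if either $u$ and $v$ both have length at most $k-1$ and $u=v$, or $u$ and $v$ have the same prefix of length $k-1$, the same suffix of length $k-1$, and for every word $y$ of length at most $k$ either $\sharp(u,y)=\sharp(v,y)<t$, or $\sharp(u,y)\ge t$ and $\sharp(v,y)\ge t$. Let $\mathrm{LTT}$ be the class of languages $L\subseteq A^*$ that are unions of $\approx_k^t$-classes for some $k,t>0$.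 Then $$\mathrm{FO}(N) \subseteq \mathrm{FO}(+1)\cap \mathrm{Rev} = \mathrm{LTT}\cap\mathrm{Rev},$$ and the inclusion is strict whenever $A$ has at least two letters. -/

import Mathlib

namespace WordLogic

/-! ### First-order logic over finite words -/

/-- The relation symbols used to describe words over `A`: a unary predicate `P_a` for every letter
`a`, and one binary predicate on positions. First-order logic with equality is Mathlib's. -/
inductive Symb (A : Type*) : ℕ → Type _
  | letter (a : A) : Symb A 1
  | rel : Symb A 2

/-- The relational signature with relation symbols `Symb A`. -/
def signature (A : Type*) : FirstOrder.Language := ⟨fun _ => Empty, Symb A⟩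

/-- The word `w` as a structure: the elements are the positions of `w`, the predicate `P_a` holds
exactly at the positions labelled `a`, and the binary predicate is interpreted by `R`.
The empty word gives the empty structure. -/
@[reducible] def wordStructure {A : Type*} (R : ℕ → ℕ → Prop) (w : List A) :
    (signature A).Structure (Fin w.length) where
  funMap := fun f _ => nomatch f
  RelMap := fun r x =>
    match r, x with
    | .letter a, x => w.get (x 0) = a
    | .rel, x => R (x 0) (x 1)

/-- The word `w`, with the binary predicate interpreted by `R`, satisfies the sentence `φ`. -/
def Satisfies {A : Type*} (R : ℕ → ℕ → Prop) (w : List A) (φ : (signature A).Sentence) : Prop :=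
  @FirstOrder.Language.Sentence.Realize (signature A) (Fin w.length) (wordStructure R w) φ

/-- The languages over `A` definable by a first-order sentence over the predicates `P_a` and the
binary predicate `R` on positions. -/
def FO (A : Type*) (R : ℕ → ℕ → Prop) : Set (Language A) :=
  {L | ∃ φ : (signature A).Sentence, ∀ w : List A, w ∈ L ↔ Satisfies R w φ}

/-- The successor predicate `x + 1 = y`. -/
def Succ (x y : ℕ) : Prop := x + 1 = y

/-- The neighbour predicate. -/
def Neighbour (x y : ℕ) : Prop := x + 1 = y ∨ y + 1 = x

/-! ### Reversible regular languages -/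

/-- The class of regular languages that are closed under reverse. -/
def Rev (A : Type*) : Set (Language A) :=
  {L | L.IsRegular ∧ L.reverse = L}

/-! ### Locally threshold testable languages -/

/-- `♯(u, y)`: the number of occurrences of the factor `y` in `u`, that is, the number of pairs
`(x, z)` with `u = x y z`. -/
noncomputable def occ {A : Type*} (u y : List A) : ℕ :=
  {p : List A × List A | u = p.1 ++ y ++ p.2}.ncard

/-- The relation `u ≈_k^t v`: either `u` and `v` have length at most `k - 1` and are equal, or
they have the same prefix of length `k - 1`, the same suffix of length `k - 1`, and for every word
of length at most `k` the same number of occurrences up to threshold `t`. -/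
def ThresholdEquiv {A : Type*} (k t : ℕ) (u v : List A) : Prop :=
  (u.length ≤ k - 1 ∧ v.length ≤ k - 1 ∧ u = v) ∨
  ((k - 1 ≤ u.length ∧ k - 1 ≤ v.length) ∧
    u.take (k - 1) = v.take (k - 1) ∧
    u.rtake (k - 1) = v.rtake (k - 1) ∧
    ∀ y : List A, y.length ≤ k →
      (occ u y = occ v y ∧ occ v y < t) ∨ (t ≤ occ u y ∧ t ≤ occ v y))

/-- `≈_k^t` is an equivalence relation on words. -/
def thresholdSetoid (A : Type*) (k t : ℕ) : Setoid (List A) where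
  r := ThresholdEquiv k t
  iseqv :=
    { refl := fun u => by
        rcases le_total u.length (k - 1) with h | h
        · exact Or.inl ⟨h, h, rfl⟩
        · refine Or.inr ⟨⟨h, h⟩, rfl, rfl, fun y _ => ?_⟩
          rcases lt_or_ge (occ u y) t with h' | h'
          · exact Or.inl ⟨rfl, h'⟩
          · exact Or.inr ⟨h', h'⟩
      symm := by
        rintro u v (⟨h1, h2, h3⟩ | ⟨⟨h1, h2⟩, h3, h4, h5⟩)
        · exact Or.inl ⟨h2, h1, h3.symm⟩
        · refine Or.inr ⟨⟨h2, h1⟩, h3.symm, h4.symm, fun y hy => ?_⟩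
          have := h5 y hy
          omega
      trans := by
        rintro u v w (⟨h1, h2, rfl⟩ | ⟨⟨h1, h2⟩, h3, h4, h5⟩) hvw
        · exact hvw
        · rcases hvw with ⟨g1, g2, rfl⟩ | ⟨⟨g1, g2⟩, g3, g4, g5⟩
          · exact Or.inr ⟨⟨h1, h2⟩, h3, h4, h5⟩
          · refine Or.inr ⟨⟨h1, g2⟩, h3.trans g3, h4.trans g4, fun y hy => ?_⟩
            have := h5 y hy
            have := g5 y hy
            omega }

/-- The locally threshold testable languages: the unions of classes of `≈_k^t`, for some
`k, t > 0`. -/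
def LTT (A : Type*) : Set (Language A) :=
  {L | ∃ k t : ℕ, 0 < k ∧ 0 < t ∧
    ∃ C : Set (Set (List A)), C ⊆ (thresholdSetoid A k t).classes ∧ ∀ w, w ∈ L ↔ ∃ c ∈ C, w ∈ c}

end WordLogic

/-! Everything rests on the equality FO(+1) = LTT. The languages in LTT are regular, because ≈ is a
right congruence of finite index (`isRegular_of_mem_LTT`), so intersecting with Rev only adds
invariance under reversal. FO(N) lies in FO(+1) because N is a disjunction of two successor atoms,
and its languages are reversal invariant because reversing a word is an isomorphism of neighbour
structures.

For LTT ⊆ FO(+1), finitely many conditions on prefixes, suffixes and bounded factor counts determine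
a class, and each becomes first-order by quantifying over the starting positions of factors
(`LTT_subset_FO_succ`).

The converse is Hanf locality, played as an Ehrenfeucht–Fraïssé game (`exists_snoc`,
`exists_holds_iff_of_localIso`). Neighbourhoods are compared up to a group G of orientations: G = ⊥
for the successor, G = ⊤ for the neighbour predicate, which cannot tell left from right. For G = ⊥,
a neighbourhood is either a factor or lies at an end of the word, so ≈ controls the counts
(`ThresholdEquiv.sameTypes`).

The case G = ⊤ gives strictness. Having both factors `aaba` and `abaa` is a reversal-invariant
property in FO(+1), but reversing one of two distant copies of `aaba` inside a long run of `b`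
leaves all unoriented neighbourhood counts unchanged and changes membership
(`bothOrientations_notMem_FO_neighbour`). -/

namespace WordLogic

open FirstOrder FirstOrder.Language

variable {A : Type*}

/-! ### Formulas evaluated uniformly over all words -/

/-- The word `w` satisfies the formula `φ` under the assignment `xs` of positions to variables. -/
def Holds (R : ℕ → ℕ → Prop) (w : List A) {n : ℕ} (φ : (signature A).BoundedFormula Empty n)
    (xs : Fin n → Fin w.length) : Prop :=
  @BoundedFormula.Realize (signature A) (Fin w.length) (wordStructure R w) Empty n φ Empty.elim xs

/-- Every term over the relational signature is a variable. -/
def varIndex {n : ℕ} : (signature A).Term (Empty ⊕ Fin n) → Fin n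
  | .var (.inr i) => i
  | .func f _ => nomatch f

theorem realize_eq_varIndex (R : ℕ → ℕ → Prop) (w : List A) {n : ℕ}
    (t : (signature A).Term (Empty ⊕ Fin n)) (v : Empty → Fin w.length)
    (xs : Fin n → Fin w.length) :
    @Term.realize (signature A) (Fin w.length) (wordStructure R w) _ (Sum.elim v xs) t =
      xs (varIndex t) := by
  match t with
  | .var (.inr i) => rfl
  | .func f _ => exact nomatch f

section Holds

variable {R : ℕ → ℕ → Prop} {w : List A} {n : ℕ} {xs : Fin n → Fin w.length}

theorem satisfies_iff_holds (φ : (signature A).Sentence) :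
    Satisfies R w φ ↔ Holds R w φ Fin.elim0 := by
  unfold Satisfies Holds Sentence.Realize Formula.Realize
  rw [Subsingleton.elim (default : Empty → Fin w.length) Empty.elim,
    Subsingleton.elim (default : Fin 0 → Fin w.length) Fin.elim0]

theorem holds_equal (t₁ t₂ : (signature A).Term (Empty ⊕ Fin n)) :
    Holds R w (.equal t₁ t₂) xs ↔ xs (varIndex t₁) = xs (varIndex t₂) := by
  simp only [Holds, BoundedFormula.Realize, realize_eq_varIndex]

theorem holds_letter (a : A) (ts : Fin 1 → (signature A).Term (Empty ⊕ Fin n)) :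
    Holds R w (.rel (L := signature A) (Symb.letter a) ts) xs ↔
      w.get (xs (varIndex (ts 0))) = a := by
  simp only [Holds, BoundedFormula.Realize, realize_eq_varIndex]
  rfl

theorem holds_rel (ts : Fin 2 → (signature A).Term (Empty ⊕ Fin n)) :
    Holds R w (.rel (L := signature A) Symb.rel ts) xs ↔
      R (xs (varIndex (ts 0))) (xs (varIndex (ts 1))) := by
  simp only [Holds, BoundedFormula.Realize, realize_eq_varIndex]
  rfl

theorem holds_imp (φ ψ : (signature A).BoundedFormula Empty n) :
    Holds R w (φ.imp ψ) xs ↔ (Holds R w φ xs → Holds R w ψ xs) :=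
  Iff.rfl

theorem holds_all (φ : (signature A).BoundedFormula Empty (n + 1)) :
    Holds R w φ.all xs ↔ ∀ x, Holds R w φ (Fin.snoc xs x) :=
  Iff.rfl

end Holds

/-- The relation `P` between words and tuples of their positions is defined by one formula. -/
def UniformlyDefinable (R : ℕ → ℕ → Prop) {n : ℕ}
    (P : ∀ w : List A, (Fin n → Fin w.length) → Prop) : Prop :=
  ∃ φ : (signature A).BoundedFormula Empty n, ∀ w xs, P w xs ↔ Holds R w φ xs

theorem mem_FO_iff {R : ℕ → ℕ → Prop} {L : Language A} :
    L ∈ FO A R ↔ UniformlyDefinable R (fun w (_ : Fin 0 → Fin w.length) => w ∈ L) := by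
  refine exists_congr fun φ => ⟨fun h w xs => ?_, fun h w => ?_⟩
  · rw [Subsingleton.elim xs Fin.elim0, ← satisfies_iff_holds]
    exact h w
  · rw [satisfies_iff_holds]
    exact h w _

namespace UniformlyDefinable

variable {R : ℕ → ℕ → Prop} {n : ℕ} {P Q : ∀ w : List A, (Fin n → Fin w.length) → Prop}

theorem congr (h : UniformlyDefinable R P) (hPQ : ∀ w xs, P w xs ↔ Q w xs) :
    UniformlyDefinable R Q :=
  h.imp fun _ hφ w xs => (hPQ w xs).symm.trans (hφ w xs)

theorem imp (hP : UniformlyDefinable R P) (hQ : UniformlyDefinable R Q) :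
    UniformlyDefinable R (fun w xs => P w xs → Q w xs) := by
  obtain ⟨φ, hφ⟩ := hP
  obtain ⟨ψ, hψ⟩ := hQ
  exact ⟨φ.imp ψ, fun w xs => imp_congr (hφ w xs) (hψ w xs)⟩

theorem false : UniformlyDefinable (A := A) (n := n) R (fun _ _ => False) :=
  ⟨.falsum, fun _ _ => Iff.rfl⟩

theorem not (hP : UniformlyDefinable R P) : UniformlyDefinable R (fun w xs => ¬ P w xs) :=
  hP.imp false

theorem const (p : Prop) : UniformlyDefinable (A := A) (n := n) R (fun _ _ => p) := by
  by_cases hp : p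
  · exact (false.not).congr (by simp [hp])
  · exact false.congr (by simp [hp])

theorem or (hP : UniformlyDefinable R P) (hQ : UniformlyDefinable R Q) :
    UniformlyDefinable R (fun w xs => P w xs ∨ Q w xs) :=
  (hP.not.imp hQ).congr fun _ _ => or_iff_not_imp_left.symm

theorem and (hP : UniformlyDefinable R P) (hQ : UniformlyDefinable R Q) :
    UniformlyDefinable R (fun w xs => P w xs ∧ Q w xs) :=
  (hP.imp hQ.not).not.congr fun _ _ => by tauto

theorem all {P : ∀ w : List A, (Fin (n + 1) → Fin w.length) → Prop}
    (hP : UniformlyDefinable R P) :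
    UniformlyDefinable R (fun w (xs : Fin n → Fin w.length) => ∀ x, P w (Fin.snoc xs x)) := by
  obtain ⟨φ, hφ⟩ := hP
  exact ⟨φ.all, fun w xs => by rw [holds_all]; exact forall_congr' fun x => hφ _ _⟩

theorem ex {P : ∀ w : List A, (Fin (n + 1) → Fin w.length) → Prop}
    (hP : UniformlyDefinable R P) :
    UniformlyDefinable R (fun w (xs : Fin n → Fin w.length) => ∃ x, P w (Fin.snoc xs x)) :=
  hP.not.all.not.congr fun _ _ => by simp

theorem exs {P : ∀ w : List A, (Fin n → Fin w.length) → Prop} (hP : UniformlyDefinable R P) :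
    UniformlyDefinable R (fun w (_ : Fin 0 → Fin w.length) => ∃ xs, P w xs) := by
  induction n with
  | zero =>
    refine hP.congr fun w xs => ⟨fun h => ⟨xs, h⟩, fun ⟨ys, h⟩ => ?_⟩
    rwa [Subsingleton.elim xs ys]
  | succ n ih =>
    refine (ih hP.ex).congr fun w _ => ⟨fun ⟨xs, x, h⟩ => ⟨_, h⟩, fun ⟨xs, h⟩ => ?_⟩
    exact ⟨Fin.init xs, xs (Fin.last n), by rwa [Fin.snoc_init_self]⟩

theorem forall_finite {ι : Type*} [Finite ι]
    {P : ι → ∀ w : List A, (Fin n → Fin w.length) → Prop}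
    (hP : ∀ i, UniformlyDefinable R (P i)) :
    UniformlyDefinable R (fun w xs => ∀ i, P i w xs) := by
  choose φ hφ using hP
  refine ⟨BoundedFormula.iInf φ, fun w xs => ?_⟩
  let _ := wordStructure R w
  exact (forall_congr' fun i => hφ i w xs).trans BoundedFormula.realize_iInf.symm

theorem exists_finite {ι : Type*} [Finite ι]
    {P : ι → ∀ w : List A, (Fin n → Fin w.length) → Prop}
    (hP : ∀ i, UniformlyDefinable R (P i)) :
    UniformlyDefinable R (fun w xs => ∃ i, P i w xs) :=
  (forall_finite fun i => (hP i).not).not.congr fun _ _ => by simp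

theorem eq (i j : Fin n) :
    UniformlyDefinable (A := A) R (fun w (xs : Fin n → Fin w.length) => xs i = xs j) :=
  ⟨.equal (.var (.inr i)) (.var (.inr j)), fun _ _ => by rw [holds_equal]; rfl⟩

theorem letter (a : A) (i : Fin n) :
    UniformlyDefinable R (fun w (xs : Fin n → Fin w.length) => w.get (xs i) = a) :=
  ⟨.rel (L := signature A) (Symb.letter a) fun _ => .var (.inr i),
    fun _ _ => by rw [holds_letter]; rfl⟩

theorem rel (i j : Fin n) :
    UniformlyDefinable (A := A) R (fun w (xs : Fin n → Fin w.length) => R (xs i) (xs j)) :=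
  ⟨.rel (L := signature A) Symb.rel ![.var (.inr i), .var (.inr j)],
    fun _ _ => by rw [holds_rel]; rfl⟩

end UniformlyDefinable

/-- A language that is determined by finitely many definable properties is definable. -/
theorem mem_FO_of_finite_invariants {R : ℕ → ℕ → Prop} {ι : Type*} [Finite ι]
    {P : ι → List A → Prop}
    (hP : ∀ i, UniformlyDefinable R (fun w (_ : Fin 0 → Fin w.length) => P i w))
    {L : Language A} (hL : ∀ u v, (∀ i, P i u ↔ P i v) → u ∈ L → v ∈ L) : L ∈ FO A R := by
  rw [mem_FO_iff]
  have key : UniformlyDefinable R (fun w (_ : Fin 0 → Fin w.length) =>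
      ∃ f : ι → Prop, (∃ u ∈ L, ∀ i, P i u ↔ f i) ∧ ∀ i, (P i w → f i) ∧ (f i → P i w)) :=
    .exists_finite fun f => (UniformlyDefinable.const _).and <| .forall_finite fun i =>
      ((hP i).imp (.const _)).and ((UniformlyDefinable.const _).imp (hP i))
  refine key.congr fun w _ => ⟨?_, fun hw => ⟨fun i => P i w, ⟨w, hw, fun _ => Iff.rfl⟩, ?_⟩⟩
  · rintro ⟨f, ⟨u, hu, huf⟩, hwf⟩
    exact hL u w (fun i => (huf i).trans ⟨(hwf i).2, (hwf i).1⟩) hu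
  · exact fun _ => ⟨id, id⟩

/-- The neighbour predicate can be expressed by the successor predicate. -/
theorem FO_neighbour_subset_FO_succ : FO A Neighbour ⊆ FO A Succ := by
  have key {n : ℕ} (φ : (signature A).BoundedFormula Empty n) :
      UniformlyDefinable Succ (fun w xs => Holds Neighbour w φ xs) := by
    induction φ with
    | falsum => exact .false
    | equal t₁ t₂ => exact (UniformlyDefinable.eq _ _).congr fun w xs => (holds_equal t₁ t₂).symm
    | rel r ts =>
      cases r with
      | letter a => exact (UniformlyDefinable.letter a _).congr fun w xs => (holds_letter a ts).symm
      | rel =>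
        exact ((UniformlyDefinable.rel (varIndex (ts 0)) (varIndex (ts 1))).or
          (.rel (varIndex (ts 1)) (varIndex (ts 0)))).congr fun w xs =>
            (holds_rel (R := Neighbour) ts).symm
    | imp φ ψ hφ hψ => exact hφ.imp hψ
    | all φ hφ => exact hφ.all
  rintro L ⟨φ, hφ⟩
  exact mem_FO_iff.2 ((key φ).congr fun w xs => by
    rw [Subsingleton.elim xs Fin.elim0, ← satisfies_iff_holds, hφ])

/-- Reversing a word does not change its neighbour predicate. -/
theorem reverse_eq_of_mem_FO_neighbour {L : Language A} (hL : L ∈ FO A Neighbour) :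
    L.reverse = L := by
  obtain ⟨φ, hφ⟩ := hL
  ext w
  rw [Language.mem_reverse, hφ, hφ]
  let _ := wordStructure Neighbour w
  let _ := wordStructure Neighbour w.reverse
  have hlen := w.length_reverse
  let g : Fin w.reverse.length ≃[signature A] Fin w.length :=
    { toEquiv := (finCongr hlen).trans Fin.revPerm
      map_fun' := fun f => nomatch f
      map_rel' := by
        intro n r x
        cases r with
        | letter a =>
          have h0 := (x 0).isLt
          change w[w.length - ((x 0 : ℕ) + 1)]'_ = a ↔ w.reverse[(x 0 : ℕ)] = a
          simp only [List.getElem_reverse, Nat.sub_sub, add_comm]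
        | rel =>
          have h0 := (x 0).isLt
          have h1 := (x 1).isLt
          change Neighbour (w.length - ((x 0 : ℕ) + 1)) (w.length - ((x 1 : ℕ) + 1)) ↔
            Neighbour (x 0) (x 1)
          unfold Neighbour
          omega }
  exact StrongHomClass.realize_sentence g φ

/-! ### Locality of first-order logic over words -/

/-- The letter at an integer position of a word, `none` outside the word. -/
def letterAt (w : List A) (i : ℤ) : Option A := if 0 ≤ i then w[i.toNat]? else none

theorem letterAt_natCast (w : List A) (i : ℕ) : letterAt w i = w[i]? := by
  simp [letterAt]

theorem letterAt_of_neg (w : List A) {i : ℤ} (hi : i < 0) : letterAt w i = none := by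
  simp [letterAt, hi]

theorem letterAt_ne_none_iff {w : List A} {i : ℤ} :
    letterAt w i ≠ none ↔ 0 ≤ i ∧ i < w.length := by
  unfold letterAt
  split_ifs with h
  · rw [Ne, List.getElem?_eq_none_iff]
    omega
  · simp [h]

theorem letterAt_eq_none_iff {w : List A} {i : ℤ} :
    letterAt w i = none ↔ i < 0 ∨ w.length ≤ i := by
  rw [← not_iff_not, ← Ne, letterAt_ne_none_iff]
  omega

theorem letterAt_fin (w : List A) (i : Fin w.length) : letterAt w i = some (w.get i) := by
  simp [letterAt_natCast]

/-- The positions of `w` whose neighbourhood of radius `r` is described by `τ`, up to an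
orientation in `G`. -/
def typeSet (G : Subgroup ℤˣ) (r : ℕ) (w : List A) (τ : ℤ → Option A) : Set ℤ :=
  {x | letterAt w x ≠ none ∧
    ∃ ε ∈ G, ∀ d : ℤ, d.natAbs ≤ r → letterAt w (x + d) = τ ((ε : ℤˣ) * d)}

theorem typeSet_subset_Ico (G : Subgroup ℤˣ) (r : ℕ) (w : List A) (τ : ℤ → Option A) :
    typeSet G r w τ ⊆ Set.Ico 0 (w.length : ℤ) :=
  fun _ hx => letterAt_ne_none_iff.1 hx.1

theorem finite_typeSet (G : Subgroup ℤˣ) (r : ℕ) (w : List A) (τ : ℤ → Option A) :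
    (typeSet G r w τ).Finite :=
  (Set.finite_Ico _ _).subset (typeSet_subset_Ico G r w τ)

/-- The numbers `a` and `b` are equal or both at least `t`. -/
def ThresholdEq (t a b : ℕ) : Prop := a = b ∨ t ≤ a ∧ t ≤ b

/-- The words `u` and `v` have the same number, up to the threshold `t`, of positions with any given
neighbourhood of radius at most `r`. -/
def SameTypes (G : Subgroup ℤˣ) (r t : ℕ) (u v : List A) : Prop :=
  ∀ s ≤ r, ∀ τ, ThresholdEq t (typeSet G s u τ).ncard (typeSet G s v τ).ncard

namespace SameTypes

variable {G : Subgroup ℤˣ} {r t : ℕ} {u v : List A}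

theorem symm (h : SameTypes G r t u v) : SameTypes G r t v u := by
  intro s hs τ
  have := h s hs τ
  unfold ThresholdEq at *
  omega

theorem mono {r' t' : ℕ} (h : SameTypes G r t u v) (hr : r' ≤ r) (ht : t' ≤ t) :
    SameTypes G r' t' u v := by
  intro s hs τ
  have := h s (hs.trans hr) τ
  unfold ThresholdEq at *
  omega

end SameTypes

theorem units_mul_self_mul (ε : ℤˣ) (d : ℤ) : (ε : ℤ) * (ε * d) = d := by
  rcases Int.units_eq_one_or ε with rfl | rfl <;> simp

theorem natAbs_units_mul (ε : ℤˣ) (d : ℤ) : ((ε : ℤ) * d).natAbs = d.natAbs := by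
  rcases Int.units_eq_one_or ε with rfl | rfl <;> simp

/-- The positions `xs` of `u` and `ys` of `v` have the same neighbourhoods of radius `r`, with
the orientations `ε`. -/
structure LocalIso (r : ℕ) (u v : List A) {n : ℕ} (ε : Fin n → ℤˣ) (xs ys : Fin n → ℤ) :
    Prop where
  letter_eq : ∀ i (d : ℤ), d.natAbs ≤ r → letterAt u (xs i + d) = letterAt v (ys i + ε i * d)
  dist_iff : ∀ i j (d : ℤ), d.natAbs ≤ r → (xs j = xs i + d ↔ ys j = ys i + ε i * d)
  -- Close positions share a stretch of the word, which must be transported in a single direction.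
  orient_eq : ∀ i j (d : ℤ), d.natAbs ≤ r → xs j = xs i + d → ε i = ε j

namespace LocalIso

variable {r : ℕ} {u v : List A} {n : ℕ} {ε : Fin n → ℤˣ} {xs ys : Fin n → ℤ}

theorem symm (h : LocalIso r u v ε xs ys) : LocalIso r v u ε ys xs where
  letter_eq i d hd := by
    rw [h.letter_eq i _ ((natAbs_units_mul _ _).trans_le hd), units_mul_self_mul]
  dist_iff i j d hd := by
    rw [h.dist_iff i j _ ((natAbs_units_mul _ _).trans_le hd), units_mul_self_mul]
  orient_eq i j d hd hij := by
    refine h.orient_eq i j (ε i * d) ((natAbs_units_mul _ _).trans_le hd) ?_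
    rw [h.dist_iff i j _ ((natAbs_units_mul _ _).trans_le hd), units_mul_self_mul, hij]

theorem mono {r' : ℕ} (h : LocalIso r u v ε xs ys) (hr : r' ≤ r) : LocalIso r' u v ε xs ys where
  letter_eq i d hd := h.letter_eq i d (hd.trans hr)
  dist_iff i j d hd := h.dist_iff i j d (hd.trans hr)
  orient_eq i j d hd := h.orient_eq i j d (hd.trans hr)

/-- Extension by a pair of positions, given the conditions that involve the new positions. -/
theorem snoc (h : LocalIso r u v ε xs ys) {x y : ℤ} {η : ℤˣ}
    (hletter : ∀ d : ℤ, d.natAbs ≤ r → letterAt u (x + d) = letterAt v (y + η * d))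
    (hdist : ∀ i (d : ℤ), d.natAbs ≤ r → (x = xs i + d ↔ y = ys i + ε i * d))
    (horient : ∀ i (d : ℤ), d.natAbs ≤ r → x = xs i + d → ε i = η) :
    LocalIso r u v (Fin.snoc ε η : Fin (n + 1) → ℤˣ) (Fin.snoc xs x : Fin (n + 1) → ℤ)
      (Fin.snoc ys y : Fin (n + 1) → ℤ) where
  letter_eq i d hd := by
    induction i using Fin.lastCases with
    | last => simpa using hletter d hd
    | cast i => simpa using h.letter_eq i d hd
  dist_iff i j d hd := by
    induction i using Fin.lastCases with
    | last =>
      induction j using Fin.lastCases with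
      | last =>
        rcases Int.units_eq_one_or η with rfl | rfl <;> simp
      | cast j =>
        simp only [Fin.snoc_last, Fin.snoc_castSucc]
        -- The hypotheses measure from the old position, hence `-d`. The instances at `d` exclude
        -- opposite orientations when the distance is given on the `ys` side.
        have h1 := hdist j (-d) (by omega)
        have h2 := hdist j d hd
        have h3 := horient j (-d) (by omega)
        have h4 := horient j d hd
        rcases Int.units_eq_one_or η with rfl | rfl <;>
        rcases Int.units_eq_one_or (ε j) with h5 | h5 <;>
        simp [h5] at * <;> omega
    | cast i =>
      induction j using Fin.lastCases with
      | last => simpa using hdist i d hd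
      | cast j => simpa using h.dist_iff i j d hd
  orient_eq i j d hd := by
    induction i using Fin.lastCases with
    | last =>
      induction j using Fin.lastCases with
      | last => simp
      | cast j =>
        simp only [Fin.snoc_last, Fin.snoc_castSucc]
        exact fun hj => (horient j (-d) (by omega) (by omega)).symm
    | cast i =>
      induction j using Fin.lastCases with
      | last => simpa using horient i d hd
      | cast j => simpa using h.orient_eq i j d hd

/-- The positions at distance at most `r` from one of the positions `xs`. -/
def near (r : ℕ) {n : ℕ} (xs : Fin n → ℤ) : Set ℤ := {x | ∃ i, ∃ d : ℤ, d.natAbs ≤ r ∧ x = xs i + d}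

theorem near_subset (r : ℕ) {n : ℕ} (xs : Fin n → ℤ) :
    near r xs ⊆ (fun p : Fin n × ℤ => xs p.1 + p.2) ''
      ((Finset.univ ×ˢ Finset.Icc (-(r : ℤ)) r : Finset (Fin n × ℤ)) : Set (Fin n × ℤ)) := by
  rintro _ ⟨i, d, hd, rfl⟩
  exact ⟨(i, d), by simp; omega, rfl⟩

theorem finite_near (r : ℕ) {n : ℕ} (xs : Fin n → ℤ) : (near r xs).Finite :=
  ((Finset.finite_toSet _).image _).subset (near_subset r xs)

theorem ncard_near_le (r : ℕ) {n : ℕ} (xs : Fin n → ℤ) : (near r xs).ncard ≤ n * (2 * r + 1) := by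
  refine (Set.ncard_le_ncard (near_subset r xs) ((Finset.finite_toSet _).image _)).trans ?_
  refine (Set.ncard_image_le (Finset.finite_toSet _)).trans ?_
  rw [Set.ncard_coe_finset, Finset.card_product, Finset.card_univ, Fintype.card_fin, Int.card_Icc]
  gcongr
  omega

/-- The position `xs i + d` is transported to `ys i + ε i * d`, which keeps its type since `ε i ∈
G`. Radius `2 * r` is needed twice: an `r`-neighbourhood of a point at distance `r` must be visible,
and two points with the same image come from centres at most `2 * r` apart, which gives injectivity.
-/
theorem ncard_typeSet_inter_near_le (h : LocalIso (2 * r) u v ε xs ys) {G : Subgroup ℤˣ}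
    (hε : ∀ i, ε i ∈ G) (τ : ℤ → Option A) :
    (typeSet G r u τ ∩ near r xs).ncard ≤ (typeSet G r v τ ∩ near r ys).ncard := by
  rcases isEmpty_or_nonempty (Fin n) with hn | hn
  -- Without marked positions `choose!` below would have no default index.
  · have : near r xs = ∅ := Set.eq_empty_of_forall_notMem fun x ⟨i, _⟩ => hn.elim i
    simp [this]
  have hnear : ∀ x ∈ near r xs, ∃ i, ∃ d : ℤ, d.natAbs ≤ r ∧ x = xs i + d := fun x hx => hx
  choose! i d hd hx using hnear
  refine Set.ncard_le_ncard_of_injOn (fun x => ys (i x) + ε (i x) * d x) ?_ ?_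
    ((finite_typeSet G r v τ).subset Set.inter_subset_left)
  · rintro x ⟨⟨hxu, η, hη, hτ⟩, hxn⟩
    have hletter : ∀ e : ℤ, e.natAbs ≤ r →
        letterAt v (ys (i x) + ε (i x) * d x + e) = letterAt u (x + ε (i x) * e) := by
      intro e he
      have h1 := hd x hxn
      have h2 := natAbs_units_mul (ε (i x)) e
      have h3 : x + ε (i x) * e = xs (i x) + (d x + ε (i x) * e) := by
        linarith [hx x hxn]
      rw [h3, h.letter_eq (i x) _ (by omega), mul_add, units_mul_self_mul, add_assoc]
    refine ⟨⟨?_, η * ε (i x), mul_mem hη (hε _), fun e he => ?_⟩,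
      ⟨i x, ε (i x) * d x, ?_, rfl⟩⟩
    · have := hletter 0 (by simp)
      simp only [mul_zero, add_zero] at this
      rwa [this]
    · rw [hletter e he, hτ _ ((natAbs_units_mul _ _).trans_le he), Units.val_mul, mul_assoc]
    · rw [natAbs_units_mul]
      exact hd x hxn
  · rintro x ⟨-, hxn⟩ y ⟨-, hyn⟩ hxy
    have h1 := hd x hxn
    have h2 := hd y hyn
    have h3 := hx x hxn
    have h4 := hx y hyn
    dsimp only at hxy
    have h5 : ys (i y) = ys (i x) + (ε (i x) * d x - ε (i y) * d y) := by linarith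
    have h6 := natAbs_units_mul (ε (i x)) (d x)
    have h7 := natAbs_units_mul (ε (i y)) (d y)
    have h8 := h.symm.orient_eq _ _ _ (by omega) h5
    have h9 := (h.symm.dist_iff _ _ _ (by omega)).1 h5
    rw [← h8, ← mul_sub, units_mul_self_mul] at h9
    omega

/-- The forth step of the Ehrenfeucht–Fraïssé game. -/
theorem exists_snoc (h : LocalIso (2 * r) u v ε xs ys) {G : Subgroup ℤˣ} (hε : ∀ i, ε i ∈ G)
    {t : ℕ} (hG : SameTypes G r t u v) (ht : n * (2 * r + 1) < t) (x : Fin u.length) :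
    ∃ y : Fin v.length, ∃ η ∈ G, LocalIso r u v (Fin.snoc ε η : Fin (n + 1) → ℤˣ)
      (Fin.snoc xs (x : ℤ) : Fin (n + 1) → ℤ) (Fin.snoc ys (y : ℤ) : Fin (n + 1) → ℤ) := by
  have hxu : letterAt u (x : ℕ) ≠ none := by rw [letterAt_fin]; simp
  suffices ∃ y : ℤ, letterAt v y ≠ none ∧ ∃ η ∈ G, LocalIso r u v
      (Fin.snoc ε η : Fin (n + 1) → ℤˣ) (Fin.snoc xs (x : ℤ) : Fin (n + 1) → ℤ)
      (Fin.snoc ys y : Fin (n + 1) → ℤ) by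
    obtain ⟨y, hy, η, hη, hiso⟩ := this
    rw [letterAt_ne_none_iff] at hy
    refine ⟨⟨y.toNat, by omega⟩, η, hη, ?_⟩
    rwa [Int.toNat_of_nonneg hy.1]
  -- A move near a marked position is answered by transport; a far move by a far position of the
  -- same type.
  by_cases hx : ((x : ℕ) : ℤ) ∈ near r xs
  · obtain ⟨i, d, hd, hx⟩ := hx
    refine ⟨ys i + ε i * d, ?_, ε i, hε i, (h.mono (by omega)).snoc ?_ ?_ ?_⟩
    · rwa [← h.letter_eq i d (by omega), ← hx]
    · intro e he
      rw [hx, add_assoc, add_assoc, ← mul_add]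
      exact h.letter_eq i _ (by omega)
    · intro j e he
      rw [hx]
      have h1 := h.dist_iff i j (d - e) (by omega)
      have h2 := h.orient_eq i j (d - e) (by omega)
      have h3 := h.symm.dist_iff i j (ε i * d - ε j * e) (by
        have h6 := natAbs_units_mul (ε i) d
        have h7 := natAbs_units_mul (ε j) e
        omega)
      have h4 := h.symm.orient_eq i j (ε i * d - ε j * e) (by
        have h6 := natAbs_units_mul (ε i) d
        have h7 := natAbs_units_mul (ε j) e
        omega)
      constructor
      · intro hj
        have h5 : xs j = xs i + (d - e) := by linarith
        have h6 := h1.1 h5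
        rw [← h2 h5]
        linarith [mul_sub (ε i : ℤ) d e]
      · intro hj
        have h5 : ys j = ys i + (ε i * d - ε j * e) := by linarith
        have h6 := h3.1 h5
        rw [← h4 h5, ← mul_sub, units_mul_self_mul] at h6
        linarith
    · intro j e he hj
      exact (h.orient_eq i j (d - e) (by omega) (by linarith)).symm
  · set τ : ℤ → Option A := fun d => letterAt u (x + d) with hτ
    have hxτ : ((x : ℕ) : ℤ) ∈ typeSet G r u τ :=
      ⟨hxu, 1, one_mem G, fun d _ => by simp [hτ]⟩
    -- If the two type counts agree, the far position `x` makes the near count strictly smaller in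
    -- `u`, hence in `v`. Otherwise `v` has at least `t` positions of this type, more than fit near
    -- `ys`.
    have hlt : (typeSet G r v τ ∩ near r ys).ncard < (typeSet G r v τ).ncard := by
      have h1 := h.symm.ncard_typeSet_inter_near_le hε τ
      have h2 : (typeSet G r u τ ∩ near r xs).ncard < (typeSet G r u τ).ncard :=
        Set.ncard_lt_ncard ⟨Set.inter_subset_left, fun hss => hx (hss hxτ).2⟩
          (finite_typeSet G r u τ)
      have h3 := (Set.ncard_le_ncard (Set.inter_subset_right (s := typeSet G r v τ))
        (finite_near r ys)).trans (ncard_near_le r ys)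
      have h4 := hG r le_rfl τ
      unfold ThresholdEq at h4
      omega
    obtain ⟨y, ⟨hyv, η, hη, hyτ⟩, hyn⟩ := Set.exists_mem_notMem_of_ncard_lt_ncard hlt
      ((finite_typeSet G r v τ).subset Set.inter_subset_left)
    have hyn : y ∉ near r ys := fun hy => hyn ⟨⟨hyv, η, hη, hyτ⟩, hy⟩
    refine ⟨y, hyv, η, hη, (h.mono (by omega)).snoc ?_ ?_ ?_⟩
    · intro d hd
      rw [hyτ _ ((natAbs_units_mul _ _).trans_le hd), units_mul_self_mul]
    · intro i d hd
      exact ⟨fun hi => (hx ⟨i, d, hd, hi⟩).elim,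
        fun hi => (hyn ⟨i, _, (natAbs_units_mul _ _).trans_le hd, hi⟩).elim⟩
    · exact fun i d hd hi => (hx ⟨i, d, hd, hi⟩).elim

end LocalIso

/-- The relation `R` on positions only depends on neighbourhoods of radius one, up to an
orientation in `G`. -/
def IsLocal (G : Subgroup ℤˣ) (R : ℕ → ℕ → Prop) : Prop :=
  ∀ (u v : List A) (n : ℕ) (ε : Fin n → ℤˣ) (xs ys : Fin n → ℕ), (∀ i, ε i ∈ G) →
    LocalIso 1 u v ε (fun i => (xs i : ℤ)) (fun i => (ys i : ℤ)) →
      ∀ i j, R (xs i) (xs j) ↔ R (ys i) (ys j)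

theorem isLocal_succ : IsLocal (A := A) ⊥ Succ := by
  intro u v n ε xs ys hε h i j
  have h1 := h.dist_iff i j 1 (by simp)
  rw [Subgroup.mem_bot.1 (hε i)] at h1
  unfold Succ
  simp at h1
  omega

theorem isLocal_neighbour : IsLocal (A := A) ⊤ Neighbour := by
  intro u v n ε xs ys _ h i j
  have h1 := h.dist_iff i j 1 (by simp)
  have h2 := h.dist_iff i j (-1) (by simp)
  unfold Neighbour
  rcases Int.units_eq_one_or (ε i) with h5 | h5 <;> simp [h5] at h1 h2 <;> omega

/-- Hanf's theorem for words: the truth of a formula is determined by the numbers of positions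
with a given neighbourhood, up to a threshold, and by the neighbourhoods of the free variables. -/
theorem exists_holds_iff_of_localIso {R : ℕ → ℕ → Prop} {G : Subgroup ℤˣ}
    (hR : IsLocal (A := A) G R) {n : ℕ} (φ : (signature A).BoundedFormula Empty n) :
    ∃ r t : ℕ, ∀ (u v : List A), SameTypes G r t u v →
      ∀ (ε : Fin n → ℤˣ) (xs : Fin n → Fin u.length) (ys : Fin n → Fin v.length), (∀ i, ε i ∈ G) →
        LocalIso r u v ε (fun i => ((xs i : ℕ) : ℤ)) (fun i => ((ys i : ℕ) : ℤ)) →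
          (Holds R u φ xs ↔ Holds R v φ ys) := by
  induction φ with
  | falsum => exact ⟨0, 0, fun u v _ ε xs ys _ _ => Iff.rfl⟩
  | equal t₁ t₂ =>
    refine ⟨0, 0, fun u v _ ε xs ys _ h => ?_⟩
    rw [holds_equal, holds_equal]
    have h1 := h.dist_iff (varIndex t₂) (varIndex t₁) 0 (by simp)
    simp only [mul_zero, add_zero, Nat.cast_inj] at h1
    rw [Fin.ext_iff, Fin.ext_iff, h1]
  | rel r ts =>
    cases r with
    | letter a =>
      refine ⟨0, 0, fun u v _ ε xs ys _ h => ?_⟩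
      rw [holds_letter, holds_letter]
      have h1 := h.letter_eq (varIndex (ts 0)) 0 (by simp)
      simp only [mul_zero, add_zero] at h1
      rw [letterAt_fin, letterAt_fin, Option.some_inj] at h1
      rw [h1]
    | rel =>
      refine ⟨1, 0, fun u v _ ε xs ys hε h => ?_⟩
      rw [holds_rel, holds_rel]
      exact hR u v _ ε (fun i => xs i) (fun i => ys i) hε h _ _
  | imp φ ψ hφ hψ =>
    obtain ⟨r₁, t₁, h₁⟩ := hφ
    obtain ⟨r₂, t₂, h₂⟩ := hψ
    refine ⟨max r₁ r₂, max t₁ t₂, fun u v hG ε xs ys hε h => ?_⟩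
    rw [holds_imp, holds_imp,
      h₁ u v (hG.mono (le_max_left _ _) (le_max_left _ _)) ε xs ys hε (h.mono (le_max_left _ _)),
      h₂ u v (hG.mono (le_max_right _ _) (le_max_right _ _)) ε xs ys hε
        (h.mono (le_max_right _ _))]
  | @all n φ hφ =>
    obtain ⟨r, t, hφ⟩ := hφ
    -- The hypotheses are symmetric, so one direction suffices. A round of the game halves the
    -- radius, and the threshold must exceed the number of positions near the `n` marked ones.
    have forth : ∀ (u v : List A), SameTypes G (2 * r) (max t (n * (2 * r + 1) + 1)) u v →
        ∀ (ε : Fin n → ℤˣ) (xs : Fin n → Fin u.length) (ys : Fin n → Fin v.length),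
          (∀ i, ε i ∈ G) →
          LocalIso (2 * r) u v ε (fun i => ((xs i : ℕ) : ℤ)) (fun i => ((ys i : ℕ) : ℤ)) →
          Holds R v φ.all ys → Holds R u φ.all xs := by
      intro u v hG ε xs ys hε h hv x
      obtain ⟨y, η, hη, hiso⟩ := h.exists_snoc hε (hG.mono (by omega) le_rfl) (by omega) x
      refine (hφ u v (hG.mono (by omega) (le_max_left _ _)) (Fin.snoc ε η : Fin (n + 1) → ℤˣ)
        (Fin.snoc xs x) (Fin.snoc ys y) ?_ ?_).2 (hv y)
      · intro i
        induction i using Fin.lastCases with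
        | last => simpa using hη
        | cast i => simpa using hε i
      · convert hiso using 1
        · ext i
          induction i using Fin.lastCases <;> simp
        · ext i
          induction i using Fin.lastCases <;> simp
    exact ⟨2 * r, max t (n * (2 * r + 1) + 1), fun u v hG ε xs ys hε h =>
      ⟨forth v u hG.symm ε ys xs hε h.symm, forth u v hG ε xs ys hε h⟩⟩

/-- The language of a sentence is determined by the numbers of positions with a given
neighbourhood, up to a threshold. -/
theorem exists_mem_iff_of_sameTypes {R : ℕ → ℕ → Prop} {G : Subgroup ℤˣ}
    (hR : IsLocal (A := A) G R) {L : Language A} (hL : L ∈ FO A R) :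
    ∃ r t : ℕ, ∀ u v : List A, SameTypes G r t u v → (u ∈ L ↔ v ∈ L) := by
  obtain ⟨φ, hφ⟩ := hL
  obtain ⟨r, t, h⟩ := exists_holds_iff_of_localIso hR φ
  refine ⟨r, t, fun u v huv => ?_⟩
  rw [hφ, hφ, satisfies_iff_holds, satisfies_iff_holds]
  exact h u v huv Fin.elim0 _ _ (fun i => i.elim0)
    ⟨fun i => i.elim0, fun i => i.elim0, fun i => i.elim0⟩

/-! ### Occurrences of factors -/

/-- An occurrence is determined by its starting index. The index `u.length` matters only for the
empty factor. -/
theorem occ_eq_ncard (u y : List A) : occ u y = {i : ℕ | i ≤ u.length ∧ y <+: u.drop i}.ncard := by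
  refine Set.ncard_congr (fun p _ => p.1.length) ?_ ?_ ?_
  · rintro ⟨x, z⟩ (h : u = x ++ y ++ z)
    refine ⟨by simp [h], ?_⟩
    rw [h, List.append_assoc, List.drop_left]
    exact List.prefix_append y z
  · rintro ⟨x, z⟩ ⟨x', z'⟩ (h : u = x ++ y ++ z) (h' : u = x' ++ y ++ z') hlen
    rw [h, List.append_assoc, List.append_assoc] at h'
    obtain ⟨h1, h2⟩ := List.append_inj h' hlen
    rw [h1, List.append_cancel_left h2]
  · rintro i ⟨hi, z, hz⟩
    exact ⟨(u.take i, z), by simp [hz], by simp [hi]⟩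

theorem lt_length_of_prefix_drop {u y : List A} (hy : y ≠ []) {i : ℕ} (h : y <+: u.drop i) :
    i < u.length := by
  have h1 := h.length_le
  have h2 := List.length_pos_iff.2 hy
  rw [List.length_drop] at h1
  omega

theorem occ_eq_ncard_of_ne_nil (u : List A) {y : List A} (hy : y ≠ []) :
    occ u y = {i : ℕ | y <+: u.drop i}.ncard := by
  rw [occ_eq_ncard]
  congr 1
  ext i
  exact ⟨And.right, fun h => ⟨(lt_length_of_prefix_drop hy h).le, h⟩⟩

theorem occ_nil (u : List A) : occ u [] = u.length + 1 := by
  rw [occ_eq_ncard]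
  have : {i : ℕ | i ≤ u.length ∧ [] <+: u.drop i} = (Finset.Iic u.length : Set ℕ) := by
    ext i
    simp
  rw [this, Set.ncard_coe_finset, Nat.card_Iic]

theorem finite_occ (u y : List A) : {p : List A × List A | u = p.1 ++ y ++ p.2}.Finite := by
  refine Set.Finite.of_injOn (f := fun p => p.1.length) (t := Set.Iic u.length) ?_ ?_
    (Set.finite_Iic _)
  · rintro ⟨x, z⟩ (h : u = x ++ y ++ z)
    simp [h]
  · rintro ⟨x, z⟩ (h : u = x ++ y ++ z) ⟨x', z'⟩ (h' : u = x' ++ y ++ z') hlen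
    rw [h, List.append_assoc, List.append_assoc] at h'
    obtain ⟨h1, h2⟩ := List.append_inj h' hlen
    rw [h1, List.append_cancel_left h2]

open Classical in
theorem occ_concat (u y : List A) (a : A) :
    occ (u ++ [a]) y = occ u y + if y <:+ u ++ [a] then 1 else 0 := by
  have hinj : Function.Injective fun p : List A × List A => (p.1, p.2 ++ [a]) := by
    rintro ⟨x, z⟩ ⟨x', z'⟩ h
    simpa using h
  have himage : {p : List A × List A | u ++ [a] = p.1 ++ y ++ p.2} =
      (fun p : List A × List A => (p.1, p.2 ++ [a])) '' {p | u = p.1 ++ y ++ p.2} ∪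
        {p | u ++ [a] = p.1 ++ y ∧ p.2 = []} := by
    ext ⟨x, z⟩
    constructor
    · intro (h : u ++ [a] = x ++ y ++ z)
      rcases List.eq_nil_or_concat z with rfl | ⟨z, b, rfl⟩
      · exact Or.inr ⟨by simpa using h, rfl⟩
      · rw [List.concat_eq_append, ← List.append_assoc, List.append_singleton_inj] at h
        exact Or.inl ⟨(x, z), h.1, by simp [h.2]⟩
    · rintro (⟨⟨x', z'⟩, h : u = x' ++ y ++ z', hx⟩ | ⟨h, hz⟩)
      · obtain ⟨rfl, rfl⟩ : x' = x ∧ z' ++ [a] = z := by simpa using hx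
        simp [h]
      · obtain rfl : z = [] := hz
        simpa using h
  have hsuffix : {p : List A × List A | u ++ [a] = p.1 ++ y ∧ p.2 = []}.ncard =
      if y <:+ u ++ [a] then 1 else 0 := by
    split_ifs with h
    · obtain ⟨x, hx⟩ := h
      rw [Set.ncard_eq_one]
      refine ⟨(x, []), Set.eq_singleton_iff_unique_mem.2 ⟨⟨hx.symm, rfl⟩, ?_⟩⟩
      rintro ⟨x', z⟩ ⟨hx', rfl : z = []⟩
      rw [← hx] at hx'
      rw [List.append_cancel_right hx']
    · rw [Set.ncard_eq_zero ((finite_occ (u ++ [a]) y).subset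
        (himage.symm ▸ Set.subset_union_right))]
      exact Set.eq_empty_of_forall_notMem fun p hp => h ⟨p.1, hp.1.symm⟩
  have hfin := finite_occ (u ++ [a]) y
  rw [himage, Set.finite_union] at hfin
  unfold occ
  rw [himage, Set.ncard_union_eq ?_ hfin.1 hfin.2, Set.ncard_image_of_injective _ hinj, hsuffix]
  rw [Set.disjoint_left]
  rintro _ ⟨p, _, rfl⟩ ⟨_, h⟩
  simp at h

theorem suffix_rtake_iff {x u : List A} {n : ℕ} :
    x <:+ u.rtake n ↔ x <:+ u ∧ x.length ≤ n := by
  rw [List.rtake_eq_reverse_take_reverse, ← List.reverse_prefix, List.reverse_reverse,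
    List.prefix_take_iff, List.reverse_prefix, List.length_reverse]

/-! ### Locally threshold testable languages are regular -/

theorem mem_LTT_iff {L : Language A} :
    L ∈ LTT A ↔ ∃ k t : ℕ, 0 < k ∧ 0 < t ∧
      ∀ u v : List A, ThresholdEquiv k t u v → u ∈ L → v ∈ L := by
  constructor
  · rintro ⟨k, t, hk, ht, C, hC, hL⟩
    refine ⟨k, t, hk, ht, fun u v huv hu => ?_⟩
    obtain ⟨c, hc, huc⟩ := (hL u).1 hu
    refine (hL v).2 ⟨c, hc, ?_⟩
    obtain ⟨w, rfl⟩ := hC hc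
    exact (thresholdSetoid A k t).trans ((thresholdSetoid A k t).symm huv) huc
  · rintro ⟨k, t, hk, ht, hL⟩
    refine ⟨k, t, hk, ht, {c | ∃ u ∈ L, c = {v | ThresholdEquiv k t v u}}, ?_, fun w => ?_⟩
    · rintro _ ⟨u, -, rfl⟩
      exact ⟨u, rfl⟩
    · constructor
      · exact fun hw => ⟨_, ⟨w, hw, rfl⟩, (thresholdSetoid A k t).refl w⟩
      · rintro ⟨_, ⟨u, hu, rfl⟩, hw⟩
        exact hL u w ((thresholdSetoid A k t).symm hw) hu

/-- A new letter creates at most one occurrence of `y`, as a suffix. Since `y` has length at most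
`k`, the old suffix of length `k - 1` decides whether it appears. -/
theorem ThresholdEquiv.concat {k t : ℕ} {u v : List A} (h : ThresholdEquiv k t u v) (a : A) :
    ThresholdEquiv k t (u ++ [a]) (v ++ [a]) := by
  rcases h with ⟨-, -, rfl⟩ | ⟨⟨hu, hv⟩, hpre, hsuf, hocc⟩
  · exact (thresholdSetoid A k t).refl _
  · have key : ∀ x : List A, x.length ≤ k - 1 → (x <:+ u ↔ x <:+ v) := by
      intro x hx
      have h1 := suffix_rtake_iff (x := x) (u := u) (n := k - 1)
      have h2 := suffix_rtake_iff (x := x) (u := v) (n := k - 1)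
      rw [hsuf] at h1
      tauto
    refine Or.inr ⟨by simp; omega, ?_, ?_, fun y hy => ?_⟩
    · rw [List.take_append_of_le_length hu, List.take_append_of_le_length hv, hpre]
    · generalize k - 1 = m at *
      cases m with
      | zero => simp
      | succ m =>
        rw [List.rtake_concat_succ, List.rtake_concat_succ]
        congr 1
        have : ∀ w : List A, w.rtake m = (w.rtake (m + 1)).rtake m := by
          intro w
          simp [List.rtake_eq_reverse_take_reverse, List.take_take]
        rw [this u, this v, hsuf]
    · classical
      have hiff : y <:+ u ++ [a] ↔ y <:+ v ++ [a] := by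
        rw [List.suffix_concat_iff, List.suffix_concat_iff]
        refine or_congr_right (exists_congr fun x => and_congr_right fun hx => key x ?_)
        rw [hx, List.length_append, List.length_singleton] at hy
        omega
      rw [occ_concat, occ_concat]
      have := hocc y hy
      simp only [hiff]
      split_ifs <;> omega

theorem ThresholdEquiv.append {k t : ℕ} {u v : List A} (h : ThresholdEquiv k t u v)
    (x : List A) : ThresholdEquiv k t (u ++ x) (v ++ x) := by
  induction x using List.reverseRecOn with
  | nil => simpa using h
  | append_singleton x a ih =>
    rw [← List.append_assoc, ← List.append_assoc]
    exact ih.concat a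

/-- The data that determines the class of a word: its prefixes and suffixes of length at most
`k`, and the number of occurrences of words of length at most `k`, up to the threshold `t`. -/
def invariant (k t : ℕ) : {p : List A // p.length ≤ k} × (Bool ⊕ Fin (t + 1)) → List A → Prop
  | (p, .inl true), w => p.1 <+: w
  | (p, .inl false), w => p.1 <:+ w
  | (p, .inr j), w => j ≤ occ w p.1

theorem take_eq_of_prefix_iff {k : ℕ} {u v : List A}
    (h : ∀ p : List A, p.length ≤ k → (p <+: u ↔ p <+: v)) : u.take k = v.take k := by
  have key : ∀ {u v : List A}, (∀ p : List A, p.length ≤ k → (p <+: u ↔ p <+: v)) →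
      u.take k <+: v.take k := fun {u v} h => List.prefix_take_iff.2
    ⟨(h _ (List.length_take_le _ _)).1 (List.take_prefix _ _), List.length_take_le _ _⟩
  have h1 := key h
  exact h1.eq_of_length_le (key fun p hp => (h p hp).symm).length_le

/-- Prefixes are recorded up to length `k`, not `k - 1`, so that a word of length at most `k - 1` is
recognised exactly. -/
theorem thresholdEquiv_of_invariant_iff {k t : ℕ} (hk : 0 < k) {u v : List A}
    (h : ∀ i, invariant k t i u ↔ invariant k t i v) : ThresholdEquiv k t u v := by
  have hpre : u.take k = v.take k := take_eq_of_prefix_iff fun p hp => h (⟨p, hp⟩, .inl true)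
  have hsuf : u.reverse.take k = v.reverse.take k := take_eq_of_prefix_iff fun p hp => by
    have := h (⟨p.reverse, by simpa using hp⟩, .inl false)
    simpa only [invariant, ← List.reverse_prefix, List.reverse_reverse] using this
  have hlen := congrArg List.length hpre
  rw [List.length_take, List.length_take] at hlen
  by_cases hu : u.length ≤ k - 1
  · refine Or.inl ⟨hu, by omega, ?_⟩
    rwa [List.take_of_length_le (by omega), List.take_of_length_le (by omega)] at hpre
  · refine Or.inr ⟨by omega, ?_, ?_, fun y hy => ?_⟩
    · simpa [List.take_take] using congrArg (List.take (k - 1)) hpre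
    · simpa [List.take_take, List.rtake_eq_reverse_take_reverse] using
        congrArg (List.take (k - 1)) hsuf
    · have hy' : ∀ j ≤ t, (j ≤ occ u y ↔ j ≤ occ v y) := fun j hj =>
        h (⟨y, hy⟩, .inr ⟨j, by omega⟩)
      have h1 := hy' t le_rfl
      have h2 := hy' (occ u y)
      have h3 := hy' (occ v y)
      omega

/-- Myhill–Nerode: left quotients factor through the truth values of finitely many invariants. -/
theorem isRegular_of_mem_LTT [Finite A] {L : Language A} (hL : L ∈ LTT A) : L.IsRegular := by
  obtain ⟨k, t, hk, -, hL⟩ := mem_LTT_iff.1 hL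
  have := (List.finite_length_le A k).to_subtype
  have : Finite {p : List A // p.length ≤ k} := this
  apply Language.IsRegular.of_finite_range_leftQuotient
  let f : List A → {p : List A // p.length ≤ k} × (Bool ⊕ Fin (t + 1)) → Prop :=
    fun u i => invariant k t i u
  have hfac : Function.FactorsThrough L.leftQuotient f := by
    intro u v huv
    have h := thresholdEquiv_of_invariant_iff hk fun i => iff_of_eq (congrFun huv i)
    ext x
    rw [Language.mem_leftQuotient, Language.mem_leftQuotient]
    exact ⟨hL _ _ (h.append x), hL _ _ ((thresholdSetoid A k t).symm (h.append x))⟩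
  refine (Set.finite_range (Function.extend f L.leftQuotient fun _ => 0)).subset ?_
  rintro _ ⟨u, rfl⟩
  exact ⟨_, hfac.extend_apply _ u⟩

/-! ### Locally threshold testable languages are definable -/

/-- Either the position has a successor, where `Q` is evaluated, or it is the last one and the truth
value of `Q []` is a constant. This drives the recursions along a factor. -/
theorem uniformlyDefinable_drop_add_one {Q : List A → Prop}
    (hQ : ∀ (n : ℕ) (i : Fin n), UniformlyDefinable Succ
      (fun w (xs : Fin n → Fin w.length) => Q (w.drop (xs i)))) (n : ℕ) (i : Fin n) :
    UniformlyDefinable Succ (fun w (xs : Fin n → Fin w.length) => Q (w.drop (xs i + 1))) := by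
  have hsucc : UniformlyDefinable (A := A) Succ
      (fun w (xs : Fin (n + 1) → Fin w.length) => Succ (xs i.castSucc) (xs (Fin.last n))) := .rel _ _
  refine (((UniformlyDefinable.const (Q [])).and hsucc.ex.not).or
    (hsucc.and (hQ (n + 1) (Fin.last n))).ex).congr fun w xs => ?_
  simp only [Fin.snoc_castSucc, Fin.snoc_last]
  by_cases h : (xs i : ℕ) + 1 < w.length
  · have h1 : ∀ x : Fin w.length, Succ (xs i) x ↔ x = ⟨xs i + 1, h⟩ := fun x => by
      rw [Fin.ext_iff, eq_comm]
      rfl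
    simp [h1]
  · have h1 : ∀ x : Fin w.length, ¬ Succ (xs i) x := fun x hx => by
      unfold Succ at hx
      omega
    simp [h1, List.drop_of_length_le (not_lt.1 h)]

/-- The first position is the one without predecessor; the empty word has none and is treated apart.
-/
theorem uniformlyDefinable_of_drop {Q : List A → Prop}
    (hQ : ∀ (n : ℕ) (i : Fin n), UniformlyDefinable Succ
      (fun w (xs : Fin n → Fin w.length) => Q (w.drop (xs i)))) :
    UniformlyDefinable Succ (fun w (_ : Fin 0 → Fin w.length) => Q w) := by
  have hsucc : UniformlyDefinable (A := A) Succ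
      (fun w (xs : Fin 2 → Fin w.length) => Succ (xs (Fin.last 1)) (xs (Fin.castSucc 0))) := .rel _ _
  refine (((UniformlyDefinable.const (Q [])).and (UniformlyDefinable.const True).ex.not).or
    (hsucc.ex.not.and (hQ 1 (Fin.last 0))).ex).congr fun w xs => ?_
  simp only [Fin.snoc_castSucc, Fin.snoc_last]
  rcases w with _ | ⟨a, w⟩
  · simp
  · have h1 : ∀ x : Fin (a :: w).length, (¬ ∃ y : Fin (a :: w).length, Succ y x) ↔ x = 0 := by
      intro x
      rw [not_exists]
      unfold Succ
      constructor
      · intro h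
        by_contra hx
        have hx' : (x : ℕ) ≠ 0 := fun h0 => hx (Fin.ext h0)
        exact h ⟨x - 1, by omega⟩ (by simp; omega)
      · rintro rfl y hy
        simp at hy
    have h2 : (0 : Fin 1) = Fin.last 0 := rfl
    simp only [h2, Fin.snoc_last, h1]
    simp

theorem uniformlyDefinable_prefix_drop (p : List A) (n : ℕ) (i : Fin n) :
    UniformlyDefinable Succ (fun w (xs : Fin n → Fin w.length) => p <+: w.drop (xs i)) := by
  induction p generalizing n with
  | nil => exact (UniformlyDefinable.const True).congr fun w xs => by simp
  | cons a p ih =>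
    refine ((UniformlyDefinable.letter a i).and
      (uniformlyDefinable_drop_add_one ih n i)).congr fun w xs => ?_
    rw [List.drop_eq_getElem_cons (xs i).isLt, List.cons_prefix_cons, eq_comm]
    rfl

theorem uniformlyDefinable_drop_eq (p : List A) (n : ℕ) (i : Fin n) :
    UniformlyDefinable Succ (fun w (xs : Fin n → Fin w.length) => w.drop (xs i) = p) := by
  induction p generalizing n with
  | nil =>
    exact UniformlyDefinable.false.congr fun w xs => by
      simp
  | cons a p ih =>
    refine ((UniformlyDefinable.letter a i).and
      (uniformlyDefinable_drop_add_one (Q := (· = p)) ih n i)).congr fun w xs => ?_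
    rw [List.drop_eq_getElem_cons (xs i).isLt, List.cons_eq_cons]
    rfl

theorem uniformlyDefinable_suffix (p : List A) :
    UniformlyDefinable Succ (fun w (_ : Fin 0 → Fin w.length) => p <:+ w) := by
  refine ((UniformlyDefinable.const (p = [])).or
    (uniformlyDefinable_drop_eq p 1 (Fin.last 0)).ex).congr fun w _ => ?_
  simp only [Fin.snoc_last]
  constructor
  · rintro (rfl | ⟨x, rfl⟩)
    · exact List.nil_suffix
    · exact List.drop_suffix _ _
  · intro h
    refine or_iff_not_imp_left.2 fun hp => ?_
    have h1 := h.length_le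
    have h2 := List.length_pos_iff.2 hp
    exact ⟨⟨w.length - p.length, by omega⟩, (List.suffix_iff_eq_drop.1 h).symm⟩

theorem occ_eq_ncard_add (u y : List A) :
    occ u y = {x : Fin u.length | y <+: u.drop x}.ncard + if y = [] then 1 else 0 := by
  split_ifs with hy
  · subst hy
    simp [occ_nil, Set.ncard_univ]
  · rw [occ_eq_ncard_of_ne_nil u hy, add_zero]
    exact (Set.ncard_congr (fun (x : Fin u.length) _ => (x : ℕ)) (fun x hx => hx) (fun x y _ _ h => Fin.ext h)
      fun i hi => ⟨⟨i, lt_length_of_prefix_drop hy hi⟩, hi, rfl⟩).symm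

theorem le_ncard_iff_exists_injective {α : Type*} [Finite α] (S : Set α) (m : ℕ) :
    m ≤ S.ncard ↔ ∃ f : Fin m → α, Function.Injective f ∧ ∀ i, f i ∈ S := by
  classical
  have := Fintype.ofFinite α
  rw [← Nat.card_coe_set_eq, Nat.card_eq_fintype_card]
  constructor
  · intro h
    obtain ⟨f⟩ := Function.Embedding.nonempty_of_card_le (α := Fin m) (β := S) (by simpa using h)
    exact ⟨fun i => f i, Subtype.val_injective.comp f.injective, fun i => (f i).2⟩
  · rintro ⟨f, hf, hS⟩
    simpa using Fintype.card_le_of_injective (fun i => (⟨f i, hS i⟩ : S))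
      fun i j hij => hf (congrArg Subtype.val hij)

theorem uniformlyDefinable_le_occ (p : List A) (j : ℕ) :
    UniformlyDefinable Succ (fun w (_ : Fin 0 → Fin w.length) => j ≤ occ w p) := by
  classical
  have key (m : ℕ) : UniformlyDefinable Succ (fun w (_ : Fin 0 → Fin w.length) =>
      m ≤ {x : Fin w.length | p <+: w.drop x}.ncard) := by
    have h1 : UniformlyDefinable (A := A) Succ (fun w (xs : Fin m → Fin w.length) =>
        (∀ q : Fin m × Fin m, xs q.1 = xs q.2 → q.1 = q.2) ∧ ∀ i, p <+: w.drop (xs i)) :=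
      (UniformlyDefinable.forall_finite fun q : Fin m × Fin m => (UniformlyDefinable.eq q.1 q.2).imp (.const _)).and
        (.forall_finite fun i => uniformlyDefinable_prefix_drop p m i)
    refine h1.exs.congr fun w _ => ?_
    rw [le_ncard_iff_exists_injective]
    exact exists_congr fun xs => and_congr_left' ⟨fun h a b => h (a, b), fun h q => @h q.1 q.2⟩
  -- Variables range over positions only, so the occurrence of the empty word at the very end is
  -- subtracted from the bound.
  refine (key (j - if p = [] then 1 else 0)).congr fun w _ => ?_
  rw [occ_eq_ncard_add, tsub_le_iff_right]

theorem LTT_subset_FO_succ [Finite A] : LTT A ⊆ FO A Succ := by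
  intro L hL
  obtain ⟨k, t, hk, -, hL⟩ := mem_LTT_iff.1 hL
  have := (List.finite_length_le A k).to_subtype
  have : Finite {p : List A // p.length ≤ k} := this
  refine mem_FO_of_finite_invariants (P := invariant k t) ?_ fun u v h =>
    hL u v (thresholdEquiv_of_invariant_iff hk h)
  rintro ⟨p, (_ | _) | j⟩
  · exact uniformlyDefinable_suffix p.1
  · exact uniformlyDefinable_of_drop (uniformlyDefinable_prefix_drop p.1)
  · exact uniformlyDefinable_le_occ p.1 j

/-! ### Languages definable with the successor are locally threshold testable -/

theorem letterAt_eq_of_take_eq {u v : List A} {m : ℕ} (h : u.take m = v.take m) {i : ℤ}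
    (hi : i < m) : letterAt u i = letterAt v i := by
  rcases lt_or_ge i 0 with h0 | h0
  · rw [letterAt_of_neg u h0, letterAt_of_neg v h0]
  · lift i to ℕ using h0
    have h1 := congrArg (·[i]?) h
    simpa [letterAt_natCast, List.getElem?_take, Nat.cast_lt.1 hi] using h1

theorem letterAt_eq_of_rtake_eq {u v : List A} {m : ℕ} (h : u.rtake m = v.rtake m)
    (hu : m ≤ u.length) (hv : m ≤ v.length) {i : ℤ} (hi : u.length - m ≤ i) :
    letterAt u i = letterAt v (i - u.length + v.length) := by
  obtain ⟨j, hj⟩ := Int.eq_ofNat_of_zero_le (sub_nonneg.2 hi)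
  have h1 := congrArg (·[j]?) h
  simp only [List.rtake, List.getElem?_drop] at h1
  rw [← letterAt_natCast, ← letterAt_natCast] at h1
  convert h1 using 2 <;> omega

theorem mem_typeSet_bot {r : ℕ} {w : List A} {τ : ℤ → Option A} {x : ℤ} :
    x ∈ typeSet ⊥ r w τ ↔
      letterAt w x ≠ none ∧ ∀ d : ℤ, d.natAbs ≤ r → letterAt w (x + d) = τ d := by
  simp [typeSet]

/-- A neighbourhood centred at `x` that stays inside the word is an occurrence, starting at `x - r`,
of a factor of length `2 * r + 1`. -/
theorem ncard_typeSet_bot_eq_occ (w : List A) (r : ℕ) (τ : ℤ → A) :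
    (typeSet ⊥ r w fun d => some (τ d)).ncard =
      occ w (List.ofFn fun i : Fin (2 * r + 1) => τ (i - r)) := by
  rw [occ_eq_ncard_of_ne_nil w (by simp)]
  refine (Set.ncard_congr (fun (i : ℕ) _ => (i : ℤ) + r) ?_ ?_ ?_).symm
  · intro i hi
    have key : ∀ d : ℤ, d.natAbs ≤ r → letterAt w (i + r + d) = some (τ d) := by
      intro d hd
      have h1 := List.prefix_iff_getElem?.1 hi (d + r).toNat (by simp; omega)
      rw [List.getElem?_drop, ← letterAt_natCast, List.getElem_ofFn] at h1
      convert h1 using 2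
      · push_cast
        omega
      · congr 1
        simp only
        omega
    refine mem_typeSet_bot.2 ⟨?_, key⟩
    have := key 0 (by simp)
    rw [add_zero] at this
    simp [this]
  · intro i j _ _ h
    simpa using h
  · intro x hx
    rw [mem_typeSet_bot] at hx
    have h0 : 0 ≤ x - r := by
      have h1 : letterAt w (x + -r) ≠ none := by
        rw [hx.2 _ (by simp)]
        simp
      have := (letterAt_ne_none_iff.1 h1).1
      omega
    refine ⟨(x - r).toNat, ?_, by omega⟩
    refine List.prefix_iff_getElem?.2 fun i hi => ?_
    rw [List.length_ofFn] at hi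
    rw [List.getElem?_drop, ← letterAt_natCast, List.getElem_ofFn, ← hx.2 _ (by simp; omega)]
    congr 1
    push_cast
    omega

/-- Such a neighbourhood leaves the word, so its centre is within `r` of an end and the common
prefix or suffix of length `m` covers what is visible. Centres are kept at the left end and shifted
by the length difference at the right end. -/
theorem ncard_typeSet_bot_le_of_eq_none {u v : List A} {m r : ℕ} (hm : 2 * r + 1 ≤ m)
    (hpre : u.take m = v.take m) (hsuf : u.rtake m = v.rtake m) (hu : m ≤ u.length)
    (hv : m ≤ v.length) {τ : ℤ → Option A} {d₀ : ℤ} (hd₀ : d₀.natAbs ≤ r) (hτ : τ d₀ = none) :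
    (typeSet ⊥ r u τ).ncard ≤ (typeSet ⊥ r v τ).ncard := by
  have hedge : ∀ x ∈ typeSet ⊥ r u τ, x < r ∨ u.length - r ≤ x := by
    intro x hx
    have h1 := (mem_typeSet_bot.1 hx).2 d₀ hd₀
    rw [hτ, letterAt_eq_none_iff] at h1
    omega
  refine Set.ncard_le_ncard_of_injOn
    (fun x => if x < r then x else x - u.length + v.length) ?_ ?_ (finite_typeSet _ _ _ _)
  · intro x hx
    have h1 := hedge x hx
    rw [mem_typeSet_bot] at hx ⊢
    have key : ∀ d : ℤ, d.natAbs ≤ r → letterAt u (x + d) =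
        letterAt v ((if x < r then x else x - u.length + v.length) + d) := by
      intro d hd
      split_ifs with h2
      · exact letterAt_eq_of_take_eq hpre (by omega)
      · rw [letterAt_eq_of_rtake_eq hsuf hu hv (by omega)]
        congr 1
        ring
    refine ⟨?_, fun d hd => (key d hd).symm.trans (hx.2 d hd)⟩
    have := key 0 (by simp)
    rw [add_zero, add_zero] at this
    exact this ▸ hx.1
  · intro x hx y hy hxy
    have h1 := hedge x hx
    have h2 := hedge y hy
    dsimp only at hxy
    split_ifs at hxy <;> omega

/-- With `k = 2 * r + 2`, the ends of length `k - 1` have the full width of a neighbourhood. Types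
that leave the word then have exactly equal counts; the others are factors and are counted up to
`t`. -/
theorem ThresholdEquiv.sameTypes {r t : ℕ} {u v : List A}
    (h : ThresholdEquiv (2 * r + 2) t u v) : SameTypes ⊥ r t u v := by
  rcases h with ⟨-, -, rfl⟩ | ⟨⟨hu, hv⟩, hpre, hsuf, hocc⟩
  · exact fun _ _ _ => Or.inl rfl
  · intro s hs τ
    by_cases hτ : ∃ d₀ : ℤ, d₀.natAbs ≤ s ∧ τ d₀ = none
    · obtain ⟨d₀, hd₀, hτ⟩ := hτ
      exact Or.inl (le_antisymm
        (ncard_typeSet_bot_le_of_eq_none (by omega) hpre hsuf hu hv hd₀ hτ)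
        (ncard_typeSet_bot_le_of_eq_none (by omega) hpre.symm hsuf.symm hv hu hd₀ hτ))
    · push Not at hτ
      have hA : Nonempty A := by
        obtain ⟨a, -⟩ := Option.ne_none_iff_exists.1 (hτ 0 (by simp))
        exact ⟨a⟩
      have hsome : ∀ d : ℤ, ∃ a, d.natAbs ≤ s → τ d = some a := by
        intro d
        by_cases hd : d.natAbs ≤ s
        · obtain ⟨a, ha⟩ := Option.ne_none_iff_exists'.1 (hτ d hd)
          exact ⟨a, fun _ => ha⟩
        · exact ⟨hA.some, fun h => (hd h).elim⟩
      choose σ hσ using hsome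
      have heq : ∀ w : List A, typeSet ⊥ s w τ = typeSet ⊥ s w fun d => some (σ d) := by
        intro w
        ext x
        rw [mem_typeSet_bot, mem_typeSet_bot]
        exact and_congr_right fun _ => forall₂_congr fun d hd => by rw [hσ d hd]
      rw [heq, heq, ncard_typeSet_bot_eq_occ, ncard_typeSet_bot_eq_occ]
      have := hocc (List.ofFn fun i : Fin (2 * s + 1) => σ (i - s)) (by simp; omega)
      unfold ThresholdEq
      omega

theorem FO_succ_subset_LTT : FO A Succ ⊆ LTT A := by
  intro L hL
  obtain ⟨r, t, h⟩ := exists_mem_iff_of_sameTypes isLocal_succ hL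
  -- The threshold `t` may be zero, hence `t + 1`.
  refine mem_LTT_iff.2 ⟨2 * r + 2, t + 1, by omega, by omega, fun u v huv => (h u v ?_).1⟩
  exact huv.sameTypes.mono le_rfl (Nat.le_succ t)

/-! ### A separating language -/

open Classical in
/-- The word of length `n` with the letter `a` at the positions in `S` and the letter `b`
elsewhere. -/
noncomputable def indicatorWord (a b : A) (n : ℕ) (S : ℕ → Prop) : List A :=
  List.ofFn fun i : Fin n => if S i then a else b

theorem letterAt_indicatorWord_eq {a b : A} {n : ℕ} {S T : ℕ → Prop} {i j : ℤ}
    (hij : (0 ≤ i ∧ i < n) ↔ (0 ≤ j ∧ j < n))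
    (h : 0 ≤ i → i < n → 0 ≤ j → j < n → (S i.toNat ↔ T j.toNat)) :
    letterAt (indicatorWord a b n S) i = letterAt (indicatorWord a b n T) j := by
  by_cases hi : 0 ≤ i ∧ i < n
  · have hj := hij.1 hi
    have h1 := h hi.1 hi.2 hj.1 hj.2
    have h2 : i.toNat < n := by omega
    have h3 : j.toNat < n := by omega
    by_cases h4 : T j.toNat <;> simp [letterAt, indicatorWord, hi.1, hj.1, h2, h3, h1, h4]
  · have hj := mt hij.2 hi
    rw [letterAt_eq_none_iff.2, letterAt_eq_none_iff.2] <;> simp [indicatorWord] <;> omega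

theorem prefix_drop_indicatorWord_iff {a b : A} (hab : a ≠ b) {n : ℕ} {S : ℕ → Prop} {x : ℕ}
    {m : ℕ} (p : Fin m → Prop) [DecidablePred p] (hx : x + m ≤ n) :
    (List.ofFn fun i => if p i then a else b) <+: (indicatorWord a b n S).drop x ↔
      ∀ i : Fin m, p i ↔ S (x + i) := by
  rw [List.prefix_iff_getElem?, Fin.forall_iff]
  simp only [List.length_ofFn]
  refine forall₂_congr fun i hi => ?_
  have h1 : x + i < n := by omega
  simp only [List.getElem?_drop, indicatorWord, List.getElem?_ofFn, h1, List.getElem_ofFn,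
    dif_pos, Option.some_inj]
  by_cases h2 : p ⟨i, hi⟩ <;> by_cases h3 : S (x + i) <;> simp [h2, h3, hab, hab.symm]

theorem infix_indicatorWord_iff {a b : A} (hab : a ≠ b) {n : ℕ} {S : ℕ → Prop} {m : ℕ}
    (p : Fin m → Prop) [DecidablePred p] :
    (List.ofFn fun i => if p i then a else b) <:+: indicatorWord a b n S ↔
      ∃ x, x + m ≤ n ∧ ∀ i : Fin m, p i ↔ S (x + i) := by
  constructor
  · rintro ⟨y, z, hyz⟩
    have hlen := congrArg List.length hyz
    simp only [indicatorWord, List.length_append, List.length_ofFn] at hlen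
    have hx : y.length + m ≤ n := by omega
    refine ⟨y.length, hx, (prefix_drop_indicatorWord_iff hab p hx).1 ?_⟩
    rw [← hyz, List.append_assoc, List.drop_left]
    exact List.prefix_append _ _
  · rintro ⟨x, hx, h⟩
    exact ((prefix_drop_indicatorWord_iff hab p hx).2 h).isInfix.trans (List.drop_suffix _ _).isInfix

/-- Words that are related by a local symmetry of their positions have the same neighbourhoods. -/
theorem sameTypes_top_of_involutive {u v : List A} {r : ℕ} {π : ℤ → ℤ} {ε : ℤ → ℤˣ}
    (hπ : Function.Involutive π) (hε : ∀ x, ε (π x) = ε x)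
    (h : ∀ x d : ℤ, d.natAbs ≤ r → letterAt u (x + d) = letterAt v (π x + ε x * d)) (t : ℕ) :
    SameTypes ⊤ r t u v := by
  have key : ∀ u v : List A,
      (∀ x d : ℤ, d.natAbs ≤ r → letterAt u (x + d) = letterAt v (π x + ε x * d)) →
        ∀ s ≤ r, ∀ τ, (typeSet ⊤ s u τ).ncard ≤ (typeSet ⊤ s v τ).ncard := by
    intro u v h s hs τ
    refine Set.ncard_le_ncard_of_injOn π ?_ hπ.injective.injOn (finite_typeSet _ _ _ _)
    rintro x ⟨hx, η, -, hτ⟩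
    refine ⟨?_, η * ε x, Subgroup.mem_top _, fun d hd => ?_⟩
    · have := h x 0 (by simp)
      rw [mul_zero, add_zero, add_zero] at this
      rwa [← this]
    · have hd' := (natAbs_units_mul (ε x) d).trans_le hd
      rw [Units.val_mul, mul_assoc, ← hτ _ hd', h x _ (hd'.trans hs), units_mul_self_mul]
  -- Since `π` is an involution preserving `ε`, the hypothesis also holds with `u` and `v`
  -- exchanged.
  refine fun s hs τ => Or.inl (le_antisymm (key u v h s hs τ) (key v u (fun x d hd => ?_) s hs τ))
  rw [h (π x) _ ((natAbs_units_mul (ε x) d).trans_le hd), hπ, hε, units_mul_self_mul]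

theorem infix_iff_one_le_occ {p w : List A} : p <:+: w ↔ 1 ≤ occ w p := by
  unfold occ
  rw [Nat.one_le_iff_ne_zero, Ne, Set.ncard_eq_zero (finite_occ w p), ← Ne,
    ← Set.nonempty_iff_ne_empty]
  exact ⟨fun ⟨x, z, h⟩ => ⟨(x, z), h.symm⟩, fun ⟨p, h⟩ => ⟨p.1, p.2, h.symm⟩⟩

/-- The words with both a factor `aaba` and a factor `abaa`. -/
def bothOrientations (a b : A) : Language A :=
  {w | [a, a, b, a] <:+: w ∧ [a, b, a, a] <:+: w}

theorem mem_bothOrientations {a b : A} {w : List A} :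
    w ∈ bothOrientations a b ↔ [a, a, b, a] <:+: w ∧ [a, b, a, a] <:+: w :=
  Iff.rfl

theorem bothOrientations_mem_FO_succ (a b : A) : bothOrientations a b ∈ FO A Succ := by
  refine mem_FO_iff.2 (((uniformlyDefinable_le_occ [a, a, b, a] 1).and
    (uniformlyDefinable_le_occ [a, b, a, a] 1)).congr fun w _ => ?_)
  rw [mem_bothOrientations, infix_iff_one_le_occ, infix_iff_one_le_occ]

theorem reverse_bothOrientations (a b : A) :
    (bothOrientations a b).reverse = bothOrientations a b := by
  ext w
  rw [Language.mem_reverse, mem_bothOrientations, mem_bothOrientations, and_comm,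
    ← List.reverse_infix (l₁ := [a, a, b, a]), ← List.reverse_infix (l₁ := [a, b, a, a]),
    List.reverse_reverse]
  simp

theorem bothOrientations_notMem_FO_neighbour {a b : A} (hab : a ≠ b) :
    bothOrientations a b ∉ FO A Neighbour := by
  intro hL
  obtain ⟨r, t, h⟩ := exists_mem_iff_of_sameTypes isLocal_neighbour hL
  obtain ⟨n, hn⟩ : ∃ n, n = r + 10 := ⟨_, rfl⟩
  -- `S` writes `aaba` at `n` and at `3 * n`; `T` writes `aaba` at `n` and `abaa` at `3 * n`.
  let S : ℕ → Prop := fun i =>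
    i = n ∨ i = n + 1 ∨ i = n + 3 ∨ i = 3 * n ∨ i = 3 * n + 1 ∨ i = 3 * n + 3
  let T : ℕ → Prop := fun i =>
    i = n ∨ i = n + 1 ∨ i = n + 3 ∨ i = 3 * n ∨ i = 3 * n + 2 ∨ i = 3 * n + 3
  have hsame : SameTypes ⊤ r t (indicatorWord a b (5 * n) S) (indicatorWord a b (5 * n) T) := by
    refine sameTypes_top_of_involutive
      -- The reflection exchanges `3 * n` and `3 * n + 3`, turning the second block around. As `n >
      -- r + 3`, only letters `b` lie within `r` of the borders of the window, so the jump there is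
      -- invisible.
      (π := fun x => if 2 * n + 2 ≤ x ∧ x ≤ 4 * n + 1 then 6 * n + 3 - x else x)
      (ε := fun x => if 2 * n + 2 ≤ x ∧ x ≤ 4 * n + 1 then -1 else 1) ?_ ?_ ?_ t
    · intro x
      dsimp only
      split_ifs <;> omega
    · intro x
      split_ifs <;> first | rfl | omega
    · intro x d hd
      split_ifs with hx
      · apply letterAt_indicatorWord_eq <;> simp only [S, T, Units.val_neg, Units.val_one] <;> omega
      · apply letterAt_indicatorWord_eq <;> simp only [S, T, Units.val_one] <;> omega
  have haaba := fun S => infix_indicatorWord_iff hab (n := 5 * n) (S := S)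
    fun i : Fin 4 => (i : ℕ) ≠ 2
  have habaa := fun S => infix_indicatorWord_iff hab (n := 5 * n) (S := S)
    fun i : Fin 4 => (i : ℕ) ≠ 1
  simp [List.ofFn_succ, Fin.forall_fin_succ] at haaba habaa
  have h1 := h _ _ hsame
  rw [mem_bothOrientations, mem_bothOrientations, haaba, haaba, habaa, habaa] at h1
  -- The word of `T` has both factors, so the word of `S` would contain `abaa`.
  obtain ⟨-, x, hx⟩ := h1.2 ⟨⟨n, by refine ⟨by omega, ?_, ?_, ?_, ?_⟩ <;> simp [T] <;> omega⟩,
    ⟨3 * n, by refine ⟨by omega, ?_, ?_, ?_, ?_⟩ <;> simp [T] <;> omega⟩⟩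
  simp only [S] at hx
  omega

end WordLogic

theorem mainTheorem3 (A : Type*) [Finite A] :
    WordLogic.FO A WordLogic.Neighbour ⊆ WordLogic.FO A WordLogic.Succ ∩ WordLogic.Rev A ∧
    (Nontrivial A →
      WordLogic.FO A WordLogic.Neighbour ⊂ WordLogic.FO A WordLogic.Succ ∩ WordLogic.Rev A) ∧
    WordLogic.FO A WordLogic.Succ ∩ WordLogic.Rev A = WordLogic.LTT A ∩ WordLogic.Rev A := by
  have hFO : WordLogic.FO A WordLogic.Succ = WordLogic.LTT A :=
    WordLogic.FO_succ_subset_LTT.antisymm WordLogic.LTT_subset_FO_succ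
  have hregular : ∀ L ∈ WordLogic.FO A WordLogic.Succ, L.IsRegular := fun L hL =>
    WordLogic.isRegular_of_mem_LTT (hFO ▸ hL)
  have hsub : WordLogic.FO A WordLogic.Neighbour ⊆
      WordLogic.FO A WordLogic.Succ ∩ WordLogic.Rev A := fun L hL =>
    have hL' := WordLogic.FO_neighbour_subset_FO_succ hL
    ⟨hL', hregular L hL', WordLogic.reverse_eq_of_mem_FO_neighbour hL⟩
  refine ⟨hsub, fun ⟨a, b, hab⟩ => ⟨hsub, fun hsup => ?_⟩, by rw [hFO]⟩
  have hL := WordLogic.bothOrientations_mem_FO_succ a b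
  exact WordLogic.bothOrientations_notMem_FO_neighbour hab
    (hsup ⟨hL, hregular _ hL, WordLogic.reverse_bothOrientations a b⟩)
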